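/- Let $S$ be a set of $n > 3$ points in the plane in general position (no three of them are collinear), and let $x$ be the number of points of $S$ that lie on the boundary of the convex hull of $S$. Suppose that $x < n$. Then $S$ has a polygonization, that is, a simple polygon whose vertex set is $S$, in which every interior angle has measure at most $$2\pi - \frac{\pi}{(n-1)(n-x)}.$$ -/

import Mathlib

open Topology

noncomputable section

/-- The Euclidean plane. -/
abbrev Plane : Type := EuclideanSpace ℝ (Fin 2)

/-- A set of points is in general position if no three distinct points of it are collinear. -/
def InGeneralPosition (S : Set Plane) : Prop :=
  ∀ p ∈ S, ∀ q ∈ S, ∀ r ∈ S, p ≠ q → p ≠ r → q ≠ r → ¬ Collinear ℝ ({p, q, r} : Set Plane)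

/-- The extremal points of `S`: the points of `S` that lie on (the boundary of) its convex hull. -/
def extremalPoints (S : Set Plane) : Set Plane :=
  S ∩ frontier (convexHull ℝ S)

namespace Polygon

variable {n : ℕ}

/-- A closed polygonal chain is a simple polygon if it has at least three vertices, they are
distinct, and two distinct edges have no point in common except a common endpoint. -/
def IsSimple (P : Polygon Plane n) : Prop :=
  3 ≤ n ∧ Function.Injective P.vertices ∧
    ∀ i j : Fin n, i ≠ j →
      P.edgeSet ℝ i ∩ P.edgeSet ℝ j ⊆ {P i, P (finRotate n i)} ∩ {P j, P (finRotate n j)}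

/-- `P` is a polygonization of `S`: a simple polygon whose vertex set is `S`. -/
def IsPolygonization (P : Polygon Plane n) (S : Set Plane) : Prop :=
  P.IsSimple ∧ Set.range P.vertices = S

/-- The open region bounded by `P`: the points off the boundary curve whose connected component
in the complement of the boundary curve is bounded. -/
def interiorRegion (P : Polygon Plane n) : Set Plane :=
  {p | p ∈ (P.boundary ℝ)ᶜ ∧ Bornology.IsBounded (connectedComponentIn (P.boundary ℝ)ᶜ p)}

/-- The set of directions (as angles in `(-π, π]`) in which one enters the interior of `P` when
leaving the `i`-th vertex: the interior angle at that vertex, as a sector of directions. -/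
def interiorDirections (P : Polygon Plane n) (i : Fin n) : Set ℝ :=
  {θ | θ ∈ Set.Ioc (-Real.pi) Real.pi ∧
    ∀ᶠ t : ℝ in 𝓝[>] 0, P i + t • (!₂[Real.cos θ, Real.sin θ] : Plane) ∈ P.interiorRegion}

/-- The measure in radians of the interior angle of `P` at its `i`-th vertex: the total measure
of the directions at that vertex that point into the interior of `P`. -/
def interiorAngle (P : Polygon Plane n) (i : Fin n) : ℝ :=
  (MeasureTheory.volume (P.interiorDirections i)).toReal

end Polygon

end

/-! Let I be the set of the n - x points of S off the hull boundary. The ordered pairs of a point of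
I and another point of S number (n-1)(n-x), so some open arc of length β = π/((n-1)(n-x)) contains
no direction of a line through such a pair (`exists_gap_side`). Take a generic γ in this arc and
call it vertical. Let l and u be the leftmost and rightmost points; join the points above line lu
from left to right, then those below from right to left (`exists_isMonotoneChain`). This monotone
chain is a simple polygon. Consider a vertex p in I on the upper chain. Turning the vertical within
the arc never moves a point across the line through p, so each ray from p in the arc avoids the rest
of the upper chain; it also climbs away from lu, hence avoids the lower chain. It escapes to
infinity, so the interior angle misses the arc (`Polygon.interiorAngle_le_of_arc`). The lower chain
uses the opposite arc. Vertices on the hull, and l and u, have angle at most π ≤ 2π - β by a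
supporting line. -/

noncomputable section

/-! ### Directions in the plane and a gap between them -/

/-- The unit vector in direction `θ`. -/
def unitVec (θ : ℝ) : Plane := !₂[Real.cos θ, Real.sin θ]

@[simp] lemma unitVec_zero (θ : ℝ) : unitVec θ 0 = Real.cos θ := rfl

@[simp] lemma unitVec_one (θ : ℝ) : unitVec θ 1 = Real.sin θ := rfl

lemma norm_unitVec (θ : ℝ) : ‖unitVec θ‖ = 1 := by
  rw [EuclideanSpace.norm_eq]
  simp [Fin.sum_univ_two]

lemma unitVec_add_pi (θ : ℝ) : unitVec (θ + Real.pi) = -unitVec θ := by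
  ext i; fin_cases i <;> simp

lemma unitVec_sub_int_mul (θ : ℝ) (m : ℤ) : unitVec (θ - m * (2 * Real.pi)) = unitVec θ := by
  ext i
  fin_cases i
  · exact Real.cos_sub_int_mul_two_pi θ m
  · exact Real.sin_sub_int_mul_two_pi θ m

lemma exists_polar (v : Plane) :
    ∃ r a : ℝ, 0 ≤ r ∧ v 0 = r * Real.cos a ∧ v 1 = r * Real.sin a := by
  refine ⟨‖(⟨v 0, v 1⟩ : ℂ)‖, Complex.arg ⟨v 0, v 1⟩, norm_nonneg _, ?_, ?_⟩
  · simp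
  · simp

/-- The side of the line through `0` in direction `θ` on which `v` lies. -/
def side (θ : ℝ) : Plane →ₗ[ℝ] ℝ where
  toFun v := Real.cos θ * v 1 - Real.sin θ * v 0
  map_add' v w := by simp; ring
  map_smul' c v := by simp; ring

lemma side_apply (θ : ℝ) (v : Plane) : side θ v = Real.cos θ * v 1 - Real.sin θ * v 0 := rfl

@[simp] lemma side_unitVec (θ : ℝ) : side θ (unitVec θ) = 0 := by
  simp [side_apply]; ring

lemma continuous_side (v : Plane) : Continuous fun θ => side θ v := by
  simp only [side_apply]; fun_prop

/-- Directions for which `v` lies on the line are those congruent to the argument of `v`. -/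
lemma exists_side_eq_zero_iff {v : Plane} (hv : v ≠ 0) :
    ∃ a : ℝ, ∀ θ, side θ v = 0 ↔ Real.sin (θ - a) = 0 := by
  obtain ⟨r, a, hr, h0, h1⟩ := exists_polar v
  refine ⟨a, fun θ => ?_⟩
  have hr0 : r ≠ 0 := by
    rintro rfl
    apply hv
    ext i; fin_cases i <;> simp [h0, h1]
  have : side θ v = -r * Real.sin (θ - a) := by
    rw [side_apply, h0, h1, Real.sin_sub]; ring
  rw [this]; simp [hr0]

lemma countable_setOf_side_eq_zero {v : Plane} (hv : v ≠ 0) : {θ | side θ v = 0}.Countable := by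
  obtain ⟨a, ha⟩ := exists_side_eq_zero_iff hv
  refine (Set.countable_range fun k : ℤ => (k : ℝ) * Real.pi + a).mono ?_
  intro θ hθ
  obtain ⟨k, hk⟩ := Real.sin_eq_zero_iff.1 ((ha θ).1 hθ)
  exact ⟨k, by simp only; linarith⟩

/-- Among `N` directions modulo `π`, some two consecutive ones are at least `π / N` apart. -/
lemma exists_gap {ι : Type*} (F : Finset ι) (hF : F.Nonempty) (a : ι → ℝ) :
    ∃ α : ℝ, ∀ θ ∈ Set.Ioo α (α + Real.pi / F.card), ∀ i ∈ F, Real.sin (θ - a i) ≠ 0 := by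
  classical
  obtain ⟨d, hd⟩ := hF
  have hN : 0 < F.card := Finset.card_pos.2 ⟨d, hd⟩
  have hN' : (0 : ℝ) < F.card := by exact_mod_cast hN
  have hpi := Real.pi_pos
  -- Pigeonhole: [0, π) is cut into N = `F.card` bins, measured from `a d`. Since `d` sits at the
  -- left end of bin 0, only the other N - 1 directions can spoil the interior of a bin.
  set c : ι → ℤ := fun i => ⌊toIcoMod hpi 0 (a i - a d) * F.card / Real.pi⌋ with hc
  have hcard : ((F.erase d).image c).card < (Finset.Ico (0 : ℤ) F.card).card := by
    refine Finset.card_image_le.trans_lt ?_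
    rw [Finset.card_erase_of_mem hd]
    simpa using hN
  obtain ⟨k, hk, hkn⟩ := Finset.exists_mem_notMem_of_card_lt_card hcard
  rw [Finset.mem_Ico] at hk
  have hk0 : (0 : ℝ) ≤ k := by exact_mod_cast hk.1
  have hk1 : (k : ℝ) + 1 ≤ F.card := by exact_mod_cast hk.2
  refine ⟨a d + k * (Real.pi / F.card), fun θ hθ i hi hs => ?_⟩
  obtain ⟨m, hm⟩ := Real.sin_eq_zero_iff.1 hs
  have hlow : k * (Real.pi / F.card) < θ - a d := by linarith [hθ.1]
  have hupp : θ - a d < (k + 1) * (Real.pi / F.card) := by linarith [hθ.2]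
  have hpos : 0 < θ - a d := lt_of_le_of_lt (by positivity) hlow
  have hltpi : θ - a d < Real.pi := by
    refine hupp.trans_le ?_
    rw [mul_div_assoc', div_le_iff₀ hN']
    nlinarith
  by_cases hid : i = d
  · subst hid
    exact (Real.sin_pos_of_pos_of_lt_pi hpos hltpi).ne' hs
  · apply hkn
    refine Finset.mem_image.2 ⟨i, Finset.mem_erase.2 ⟨hid, hi⟩, ?_⟩
    have hmod : toIcoMod hpi 0 (a i - a d) = θ - a d := by
      have h1 : a i - a d = (θ - a d) - m • Real.pi := by
        rw [zsmul_eq_mul]; linarith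
      rw [h1, toIcoMod_sub_zsmul, toIcoMod_eq_self]
      exact ⟨hpos.le, by simpa using hltpi⟩
    rw [hc]
    simp only [hmod]
    rw [Int.floor_eq_iff, le_div_iff₀ hpi, div_lt_iff₀ hpi]
    rw [mul_div_assoc', div_lt_iff₀ hN'] at hlow
    rw [mul_div_assoc', lt_div_iff₀ hN'] at hupp
    exact ⟨hlow.le, hupp⟩

/-! ### Bounding interior angles by escaping rays and supporting lines -/

/-- If every direction in an arc leaves the `i`-th vertex along a ray that avoids the boundary,
then the interior angle misses that arc. -/
lemma Polygon.interiorAngle_le_of_arc {n : ℕ} (P : Polygon Plane n) (i : Fin n) {α β : ℝ}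
    (hβ : β ≤ 2 * Real.pi)
    (h : ∀ θ ∈ Set.Ioo α (α + β), ∀ t : ℝ, 0 < t → P i + t • unitVec θ ∉ P.boundary ℝ) :
    P.interiorAngle i ≤ 2 * Real.pi - β := by
  have hpi := Real.pi_pos
  have key : ∀ θ ∈ Set.Ioo α (α + β), ∀ m : ℤ,
      θ - m * (2 * Real.pi) ∉ P.interiorDirections i := by
    rintro θ hθ m ⟨-, hev⟩
    have hray := h θ hθ
    have hev' : ∀ᶠ t : ℝ in 𝓝[>] 0, P i + t • unitVec θ ∈ P.interiorRegion := by
      rw [← unitVec_sub_int_mul θ m]; exact hev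
    obtain ⟨t, ht, ht0⟩ := (hev'.and self_mem_nhdsWithin).exists
    have ht0 : 0 < t := ht0
    set f : ℝ → Plane := fun s => P i + s • unitVec θ with hf
    have hfc : Continuous f := by fun_prop
    have hsub : f '' Set.Ioi 0 ⊆ connectedComponentIn (P.boundary ℝ)ᶜ (f t) := by
      apply IsPreconnected.subset_connectedComponentIn
      · exact isPreconnected_Ioi.image f hfc.continuousOn
      · exact ⟨t, ht0, rfl⟩
      · rintro _ ⟨s, hs, rfl⟩
        exact hray s hs
    obtain ⟨C, hC⟩ := (ht.2.subset hsub).exists_norm_le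
    -- Far enough out that `‖f s‖ ≥ s - ‖P i‖ > C`: the component containing the ray is unbounded.
    set s := |C| + ‖P i‖ + 1 with hs
    have hs0 : 0 < s := by positivity
    have h1 := hC (f s) ⟨s, hs0, rfl⟩
    have h2 : ‖s • unitVec θ‖ ≤ ‖f s‖ + ‖P i‖ := by
      have : s • unitVec θ = f s - P i := by simp [hf]
      rw [this]; exact norm_sub_le _ _
    rw [norm_smul, norm_unitVec, Real.norm_of_nonneg hs0.le] at h2
    linarith [le_abs_self C]
  -- normalise the arc
  obtain ⟨m, hm⟩ : ∃ m : ℤ, α - m * (2 * Real.pi) ∈ Set.Ico (-Real.pi) Real.pi := by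
    have h2 : (0 : ℝ) < 2 * Real.pi := by positivity
    refine ⟨toIcoDiv h2 (-Real.pi) α, ?_⟩
    have := sub_toIcoDiv_zsmul_mem_Ico h2 (-Real.pi) α
    rw [zsmul_eq_mul] at this
    rwa [show -Real.pi + 2 * Real.pi = Real.pi by ring] at this
  set a := α - m * (2 * Real.pi) with ha
  have key' : ∀ θ ∈ P.interiorDirections i, ∀ j : ℤ,
      ¬ (a < θ + j * (2 * Real.pi) ∧ θ + j * (2 * Real.pi) < a + β) := by
    rintro θ hθ j ⟨h1, h2⟩
    refine key (θ + (j + m) * (2 * Real.pi)) ⟨by linarith, by linarith⟩ (j + m) ?_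
    push_cast
    simpa using hθ
  have bound : MeasureTheory.volume (P.interiorDirections i)
      ≤ ENNReal.ofReal (2 * Real.pi - β) := by
    -- The arc starting at `a` either ends by π, leaving two intervals, or wraps past π, leaving
    -- one.
    by_cases hw : a + β ≤ Real.pi
    · have hsub : P.interiorDirections i ⊆ Set.Ioc (-Real.pi) a ∪ Set.Icc (a + β) Real.pi := by
        intro θ hθ
        have h0 := key' θ hθ 0
        simp only [Int.cast_zero, zero_mul, add_zero, not_and, not_lt] at h0
        by_cases hc : θ ≤ a
        · exact Or.inl ⟨hθ.1.1, hc⟩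
        · exact Or.inr ⟨h0 (not_le.1 hc), hθ.1.2⟩
      refine (MeasureTheory.measure_mono hsub).trans
        ((MeasureTheory.measure_union_le _ _).trans ?_)
      rw [Real.volume_Ioc, Real.volume_Icc, ← ENNReal.ofReal_add]
      · apply ENNReal.ofReal_le_ofReal; linarith
      · linarith [hm.1]
      · linarith
    · have hsub : P.interiorDirections i ⊆ Set.Icc (a + β - 2 * Real.pi) a := by
        intro θ hθ
        have h0 := key' θ hθ 0
        have h1 := key' θ hθ 1
        simp only [Int.cast_zero, zero_mul, add_zero, not_and, not_lt] at h0
        simp only [Int.cast_one, one_mul, not_and, not_lt] at h1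
        have hlow := hθ.1.1
        have hupp := hθ.1.2
        have h3 : θ ≤ a := by
          by_contra hc
          linarith [h0 (not_le.1 hc)]
        exact ⟨by linarith [h1 (by linarith [hm.2])], h3⟩
      refine (MeasureTheory.measure_mono hsub).trans ?_
      rw [Real.volume_Icc]
      apply ENNReal.ofReal_le_ofReal; linarith
  unfold Polygon.interiorAngle
  exact ENNReal.toReal_le_of_le_ofReal (by linarith) bound

/-- A point on the boundary of the convex hull of a set that affinely spans the plane has a
supporting line. -/
lemma exists_support {S : Set Plane} (hS : affineSpan ℝ S = ⊤) {p : Plane}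
    (hp : p ∈ frontier (convexHull ℝ S)) :
    ∃ v : Plane, v ≠ 0 ∧ ∀ s ∈ S, v 0 * (s 0 - p 0) + v 1 * (s 1 - p 1) ≤ 0 := by
  have hconv := convex_convexHull ℝ S
  have hne := interior_convexHull_nonempty_iff_affineSpan_eq_top.2 hS
  obtain ⟨f, hf⟩ := geometric_hahn_banach_open_point hconv.interior isOpen_interior hp.2
  -- Separation is strict only on the interior; the weak inequality reaches S because the hull lies
  -- in the closure of its interior.
  have hle : ∀ s ∈ S, f s ≤ f p := by
    intro s hs
    have h1 : s ∈ closure (interior (convexHull ℝ S)) := by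
      rw [hconv.closure_interior_eq_closure_of_nonempty_interior hne]
      exact subset_closure (subset_convexHull ℝ S hs)
    have h2 : closure (interior (convexHull ℝ S)) ⊆ {z | f z ≤ f p} :=
      closure_minimal (fun z hz => (hf z hz).le) (isClosed_le f.continuous continuous_const)
    exact h2 h1
  set v := (InnerProductSpace.toDual ℝ Plane).symm f with hv
  have hfv : ∀ z : Plane, f z = v 0 * z 0 + v 1 * z 1 := by
    intro z
    rw [← InnerProductSpace.toDual_symm_apply (𝕜 := ℝ) (x := z) (y := f)]
    rw [PiLp.inner_apply, Fin.sum_univ_two, ← hv]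
    simp only [RCLike.inner_apply, conj_trivial]
    ring
  refine ⟨v, ?_, fun s hs => ?_⟩
  · intro h0
    obtain ⟨z, hz⟩ := hne
    have := hf z hz
    rw [hfv, hfv, h0] at this
    simp at this
  · have := hle s hs
    rw [hfv, hfv] at this
    linarith

lemma InGeneralPosition.affineSpan_eq_top {S : Finset Plane}
    (hS : InGeneralPosition (S : Set Plane)) (h : 2 < S.card) :
    affineSpan ℝ (S : Set Plane) = ⊤ := by
  obtain ⟨p, hp, q, hq, r, hr, hpq, hpr, hqr⟩ := Finset.two_lt_card.1 h
  have h1 := hS p hp q hq r hr hpq hpr hqr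
  rw [← affineIndependent_iff_not_collinear_set] at h1
  have h2 := h1.affineSpan_eq_top_iff_card_eq_finrank_add_one.2 (by simp)
  rw [eq_top_iff, ← h2]
  apply affineSpan_mono
  rintro _ ⟨i, rfl⟩
  fin_cases i
  · exact hp
  · exact hq
  · exact hr

/-- A vertex with a supporting line has an interior angle of at most `π`. -/
lemma Polygon.interiorAngle_le_pi_of_support {n : ℕ} (P : Polygon Plane n) (i : Fin n)
    {v : Plane} (hv : v ≠ 0)
    (h : ∀ j, v 0 * (P j 0 - P i 0) + v 1 * (P j 1 - P i 1) ≤ 0) :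
    P.interiorAngle i ≤ Real.pi := by
  have hpi := Real.pi_pos
  obtain ⟨r, a, hr, h0, h1⟩ := exists_polar v
  have hr0 : 0 < r := by
    refine lt_of_le_of_ne hr ?_
    rintro rfl
    apply hv
    ext i; fin_cases i <;> simp [h0, h1]
  -- The directions making an acute angle with `v` leave the half-plane that contains the polygon.
  have := P.interiorAngle_le_of_arc i (α := a - Real.pi / 2) (β := Real.pi) (by linarith) ?_
  · linarith
  intro θ hθ t ht hz
  obtain ⟨j, hj⟩ := Set.mem_iUnion.1 hz
  rw [Polygon.edgeSet, affineSegment_eq_segment] at hj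
  have hj' := h (finRotate n j)
  generalize finRotate n j = j' at hj hj'
  obtain ⟨c, d, hc, hd, hcd, hz⟩ := hj
  have e0 := congrArg (fun w : Plane => w 0) hz
  have e1 := congrArg (fun w : Plane => w 1) hz
  simp at e0 e1
  have hcos : 0 < Real.cos (θ - a) :=
    Real.cos_pos_of_mem_Ioo ⟨by linarith [hθ.1], by linarith [hθ.2]⟩
  have hpos : 0 < t * r * Real.cos (θ - a) := by positivity
  have e2 : v 0 * (t * Real.cos θ) + v 1 * (t * Real.sin θ) = t * r * Real.cos (θ - a) := by
    rw [h0, h1, Real.cos_sub]; ring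
  have e3 : c * (v 0 * (P j 0 - P i 0) + v 1 * (P j 1 - P i 1)) ≤ 0 :=
    mul_nonpos_of_nonneg_of_nonpos hc (h j)
  have e4 := mul_nonpos_of_nonneg_of_nonpos hd hj'
  have e5 : d = 1 - c := by linarith
  subst e5
  have e6 : t * Real.cos θ = c * (P j 0 - P i 0) + (1 - c) * (P j' 0 - P i 0) := by
    linarith
  have e7 : t * Real.sin θ = c * (P j 1 - P i 1) + (1 - c) * (P j' 1 - P i 1) := by
    linarith
  rw [e6, e7] at e2
  linarith

/-! ### Construction of the monotone chain -/

/-- Monotonicity of a real sequence up to an index. -/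
lemma lt_of_forall_step_lt {f : ℕ → ℝ} {a b : ℕ} (h : ∀ i, a ≤ i → i < b → f i < f (i + 1))
    {i j : ℕ} (hi : a ≤ i) (hij : i < j) (hj : j ≤ b) : f i < f j := by
  induction j, hij using Nat.le_induction with
  | base => exact h i hi hj
  | succ k hk ih => exact (ih (by omega)).trans (h k (by omega) (by omega))

/-- A closed chain `W 0, …, W n = W 0` through the points of `S` that is increasing for `g` up to
`W r` and decreasing from there on, the first part being above, and the second part below, the
level line of `h` through `W 0` and `W r`. -/
structure IsMonotoneChain (S : Finset Plane) (g h : Plane →ₗ[ℝ] ℝ) (W : ℕ → Plane)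
    (r n : ℕ) : Prop where
  pos : 0 < r
  lt : r < n
  closed : W n = W 0
  mem : ∀ i, W i ∈ S
  surj : ∀ s ∈ S, ∃ i < n, W i = s
  inj : ∀ i < n, ∀ j < n, W i = W j → i = j
  up : ∀ i < r, g (W i) < g (W (i + 1))
  down : ∀ i, r ≤ i → i < n → g (W (i + 1)) < g (W i)
  upper : ∀ i ≤ r, h (W 0) ≤ h (W i)
  lower : ∀ i, r ≤ i → i ≤ n → h (W i) ≤ h (W 0)
  level : ∀ i < n, h (W i) = h (W 0) → i = 0 ∨ i = r

lemma exists_isMonotoneChain (S : Finset Plane) (g h : Plane →ₗ[ℝ] ℝ)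
    (hg : Set.InjOn g (S : Set Plane)) {l u : Plane} (hl : l ∈ S) (hu : u ∈ S) (hlu : l ≠ u)
    (hmin : ∀ s ∈ S, g l ≤ g s) (hmax : ∀ s ∈ S, g s ≤ g u) (hhu : h u = h l)
    (hlevel : ∀ s ∈ S, h s = h l → s = l ∨ s = u) :
    ∃ W : ℕ → Plane, ∃ r : ℕ, IsMonotoneChain S g h W r S.card ∧ W 0 = l ∧ W r = u := by
  classical
  -- Points below the base line have their `g`-value reflected in `g u`, so sorting by `key` alone
  -- lists the upper points upwards, then `u`, then the lower points downwards.
  set key : Plane → ℝ := fun s => if h l ≤ h s then g s else 2 * g u - g s with hkey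
  have key_up : ∀ s, h l ≤ h s → key s = g s := fun s hs => if_pos hs
  have key_down : ∀ s, h s < h l → key s = 2 * g u - g s := fun s hs => if_neg (not_le.2 hs)
  have lt_u : ∀ s ∈ S, h s < h l → g s < g u := by
    intro s hs hlt
    refine lt_of_le_of_ne (hmax s hs) fun he => ?_
    rw [hg hs hu he, hhu] at hlt
    exact lt_irrefl _ hlt
  have key_le : ∀ s ∈ S, key s ≤ g u → h l ≤ h s ∧ key s = g s := by
    intro s hs hle
    rcases le_or_gt (h l) (h s) with h1 | h1
    · exact ⟨h1, key_up s h1⟩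
    · rw [key_down s h1] at hle
      linarith [lt_u s hs h1]
  have key_ge : ∀ s ∈ S, g u ≤ key s → h s ≤ h l ∧ key s = 2 * g u - g s := by
    intro s hs hge
    rcases le_or_gt (h l) (h s) with h1 | h1
    · rw [key_up s h1] at hge
      have he := le_antisymm (hmax s hs) hge
      have := hg hs hu he
      subst this
      exact ⟨hhu.le, by rw [key_up _ h1]; ring⟩
    · exact ⟨h1.le, key_down s h1⟩
  have key_inj : Set.InjOn key (S : Set Plane) := by
    intro s hs t ht hst
    rcases le_total (key s) (g u) with h1 | h1
    · have h2 := key_le s hs h1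
      have h3 := key_le t ht (hst ▸ h1)
      exact hg hs ht (by linarith [h2.2, h3.2])
    · have h2 := key_ge s hs h1
      have h3 := key_ge t ht (hst ▸ h1)
      exact hg hs ht (by linarith [h2.2, h3.2])
  have hcard : (S.image key).card = S.card := Finset.card_image_of_injOn key_inj
  set n := S.card with hn
  have hpre : ∀ i : Fin n, ∃ s ∈ S, key s = (S.image key).orderEmbOfFin hcard i := by
    intro i
    exact Finset.mem_image.1 (Finset.orderEmbOfFin_mem _ hcard i)
  choose V hVS hV using hpre
  have hVlt : ∀ i j : Fin n, i < j → key (V i) < key (V j) := by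
    intro i j hij
    rw [hV, hV]
    exact (OrderEmbedding.lt_iff_lt _).2 hij
  have hVle : ∀ i j : Fin n, i ≤ j → key (V i) ≤ key (V j) := by
    intro i j hij
    rw [hV, hV]
    exact (OrderEmbedding.le_iff_le _).2 hij
  have hVsurj : ∀ s ∈ S, ∃ i, V i = s := by
    intro s hs
    have : key s ∈ Set.range ((S.image key).orderEmbOfFin hcard) := by
      rw [Finset.range_orderEmbOfFin]
      exact Finset.mem_coe.2 (Finset.mem_image_of_mem _ hs)
    obtain ⟨i, hi⟩ := this
    exact ⟨i, key_inj (hVS i) hs (by rw [hV, hi])⟩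
  have hVinj : ∀ i j, V i = V j → i = j := by
    intro i j hij
    rcases lt_trichotomy i j with h1 | h1 | h1
    · exact absurd (congrArg key hij) (hVlt i j h1).ne
    · exact h1
    · exact absurd (congrArg key hij) (hVlt j i h1).ne'
  have hn0 : 0 < n := Finset.card_pos.2 ⟨l, hl⟩
  -- The default value `l` at index `n` closes the chain.
  set W : ℕ → Plane := fun i => if hi : i < n then V ⟨i, hi⟩ else l with hW
  have hWV : ∀ i (hi : i < n), W i = V ⟨i, hi⟩ := fun i hi => dif_pos hi
  have hWn : W n = l := dif_neg (lt_irrefl n)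
  have hW0 : W 0 = l := by
    rw [hWV 0 hn0]
    obtain ⟨j, hj⟩ := hVsurj l hl
    have h1 : key (V ⟨0, hn0⟩) ≤ key (V j) := hVle _ _ (Nat.zero_le _)
    rw [hj, key_up l le_rfl] at h1
    have h2 := key_le _ (hVS ⟨0, hn0⟩) (h1.trans (hmin u hu))
    apply hg (hVS _) hl
    exact le_antisymm (by linarith [h2.2]) (hmin _ (hVS _))
  obtain ⟨⟨r, hr⟩, hVr⟩ := hVsurj u hu
  have hWr : W r = u := by rw [hWV r hr, hVr]
  have key_u : key u = g u := key_up u hhu.ge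
  have hr0 : 0 < r := by
    rcases Nat.eq_zero_or_pos r with h0 | h0
    · rw [h0, hW0] at hWr
      exact absurd hWr hlu
    · exact h0
  have hmem : ∀ i, W i ∈ S := by
    intro i
    by_cases hi : i < n
    · rw [hWV i hi]; exact hVS _
    · rw [hW]; simp only [dif_neg hi]; exact hl
  have hfst : ∀ i ≤ r, h l ≤ h (W i) ∧ key (W i) = g (W i) := by
    intro i hi
    refine key_le _ (hmem i) ?_
    rw [← key_u, ← hVr, hWV i (by omega)]
    exact hVle _ _ hi
  have hsnd : ∀ i, r ≤ i → i < n → h (W i) ≤ h l ∧ key (W i) = 2 * g u - g (W i) := by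
    intro i hi hin
    refine key_ge _ (hmem i) ?_
    rw [← key_u, ← hVr, hWV i hin]
    exact hVle _ _ hi
  have hinj : ∀ i < n, ∀ j < n, W i = W j → i = j := by
    intro i hi j hj hij
    rw [hWV i hi, hWV j hj] at hij
    simpa using hVinj _ _ hij
  have hstep : ∀ i, i + 1 < n → key (W i) < key (W (i + 1)) := by
    intro i hi
    rw [hWV i (by omega), hWV (i + 1) hi]
    exact hVlt _ _ (Nat.lt_succ_self i)
  refine ⟨W, r, ⟨hr0, hr, hWn.trans hW0.symm, hmem, ?_, hinj, ?_, ?_, ?_, ?_, ?_⟩, hW0, hWr⟩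
  · intro s hs
    obtain ⟨i, hi⟩ := hVsurj s hs
    exact ⟨i, i.2, by rw [hWV i i.2, hi]⟩
  · intro i hi
    have := hstep i (by omega)
    rwa [(hfst i hi.le).2, (hfst (i + 1) hi).2] at this
  · intro i hi hin
    by_cases h1 : i + 1 < n
    · have := hstep i h1
      rw [(hsnd i hi hin).2, (hsnd (i + 1) (by omega) h1).2] at this
      linarith
    · have h2 : i + 1 = n := by omega
      -- The closing edge returns to `l`, the strict minimum of `g`.
      rw [h2, hWn]
      refine lt_of_le_of_ne (hmin _ (hmem i)) fun he => ?_
      have h3 := hg hl (hmem i) he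
      rw [← hW0] at h3
      have := hinj 0 hn0 i hin h3
      omega
  · intro i hi
    rw [hW0]; exact (hfst i hi).1
  · intro i hi hin
    rw [hW0]
    rcases hin.eq_or_lt with h1 | h1
    · rw [h1, hWn]
    · exact (hsnd i hi h1).1
  · intro i hi he
    rw [hW0] at he
    rcases hlevel _ (hmem i) he with h1 | h1
    · exact Or.inl (hinj i hi 0 hn0 (h1.trans hW0.symm))
    · exact Or.inr (hinj i hi r hr (h1.trans hWr.symm))

/-! ### Simplicity of the chain and rays that miss it -/

/-- In general position, a segment between two points of `S` contains no third one. -/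
lemma InGeneralPosition.eq_or_eq_of_mem_segment {S : Set Plane} (hS : InGeneralPosition S)
    {a b z : Plane} (ha : a ∈ S) (hb : b ∈ S) (hz : z ∈ S) (h : z ∈ segment ℝ a b) :
    z = a ∨ z = b := by
  by_contra! hne
  rcases eq_or_ne a b with rfl | hab
  · rw [segment_same] at h
    exact hne.1 h
  refine hS a ha z hz b hb hne.1.symm hab hne.2 ?_
  exact (mem_segment_iff_wbtw.1 h).collinear

/-- A ray from `p` along a level line of `φ`, where `φ` orders the points of `S` relative to `p`
in the same way as `g`, misses every segment between points of `S` on one side of `p`. -/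
lemma ray_notMem_segment {S : Finset Plane} {g φ : Plane →ₗ[ℝ] ℝ} {p q q' v : Plane}
    (hv : v ≠ 0) (hφv : φ v = 0)
    (hlt : ∀ s ∈ S, s ≠ p → g s ≤ g p → φ s < φ p) (hgt : ∀ s ∈ S, s ≠ p → g p ≤ g s → φ p < φ s)
    (hq : q ∈ S) (hq' : q' ∈ S) (hne : q ≠ q')
    (hside : g q ≤ g p ∧ g q' ≤ g p ∨ g p ≤ g q ∧ g p ≤ g q') {t : ℝ} (ht : 0 < t) :
    p + t • v ∉ segment ℝ q q' := by
  rintro ⟨a, b, ha, hb, hab, hz⟩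
  -- `φ` is constant along the ray, while both ends of the segment lie weakly on one `φ`-side of `p`
  -- and at most one of them is `p`.
  have hφ : a * φ q + b * φ q' = φ p := by
    have := congrArg φ hz
    simpa [hφv] using this
  have notp : p + t • v ≠ p := by simp [hv, ht.ne']
  have notS : ∀ s ∈ S, p + t • v ≠ s := by
    intro s hs he
    have h1 : φ s = φ p := by rw [← he]; simp [hφv]
    have h2 : s ≠ p := he ▸ notp
    rcases le_total (g s) (g p) with h3 | h3
    · exact (hlt s hs h2 h3).ne h1
    · exact (hgt s hs h2 h3).ne' h1
  have ea : a = 1 - b := by linarith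
  subst ea
  have hb0 : b ≠ 0 := by
    rintro rfl
    exact notS q hq (by rw [← hz]; simp)
  have hb1 : b ≠ 1 := by
    rintro rfl
    exact notS q' hq' (by rw [← hz]; simp)
  have hb' : 0 < b := lt_of_le_of_ne hb (Ne.symm hb0)
  have ha' : 0 < 1 - b := lt_of_le_of_ne ha (fun h => hb1 (by linarith))
  rcases hside with ⟨h1, h2⟩ | ⟨h1, h2⟩
  · by_cases e1 : q = p
    · subst e1
      have := mul_pos hb' (sub_pos.2 (hlt q' hq' hne.symm h2))
      linarith
    · have k1 := mul_pos ha' (sub_pos.2 (hlt q hq e1 h1))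
      by_cases e2 : q' = p
      · subst e2; linarith
      · have := mul_pos hb' (sub_pos.2 (hlt q' hq' e2 h2))
        linarith
  · by_cases e1 : q = p
    · subst e1
      have := mul_pos hb' (sub_pos.2 (hgt q' hq' hne.symm h2))
      linarith
    · have k1 := mul_pos ha' (sub_pos.2 (hgt q hq e1 h1))
      by_cases e2 : q' = p
      · subst e2; linarith
      · have := mul_pos hb' (sub_pos.2 (hgt q' hq' e2 h2))
        linarith

namespace IsMonotoneChain

variable {S : Finset Plane} {g h : Plane →ₗ[ℝ] ℝ} {W : ℕ → Plane} {r n : ℕ}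

lemma g_lt_of_le (c : IsMonotoneChain S g h W r n) {i j : ℕ} (hij : i < j) (hj : j ≤ r) :
    g (W i) < g (W j) :=
  lt_of_forall_step_lt (f := fun i => g (W i)) (fun i _ hi => c.up i hi) (Nat.zero_le i) hij hj

lemma g_lt_of_ge (c : IsMonotoneChain S g h W r n) {i j : ℕ} (hi : r ≤ i) (hij : i < j)
    (hj : j ≤ n) : g (W j) < g (W i) := by
  have := lt_of_forall_step_lt (f := fun i => - g (W i)) (a := r) (b := n)
    (fun i h1 h2 => neg_lt_neg (c.down i h1 h2)) hi hij hj
  simpa using this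

/-- The polygon with the vertices of the chain. -/
def polygon (_ : IsMonotoneChain S g h W r n) : Polygon Plane n := ⟨fun i => W i⟩

lemma polygon_apply (c : IsMonotoneChain S g h W r n) (i : Fin n) : c.polygon i = W i := rfl

lemma polygon_finRotate (c : IsMonotoneChain S g h W r n) (i : Fin n) :
    c.polygon (finRotate n i) = W (i + 1) := by
  rw [c.polygon_apply]
  obtain ⟨m, rfl⟩ : ∃ m, n = m + 1 := ⟨n - 1, by have := c.lt; omega⟩
  by_cases hi : i = Fin.last m
  · subst hi
    rw [finRotate_last]
    exact c.closed.symm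
  · rw [coe_finRotate_of_ne_last hi]

lemma edgeSet_polygon (c : IsMonotoneChain S g h W r n) (i : Fin n) :
    c.polygon.edgeSet ℝ i = segment ℝ (W i) (W (i + 1)) := by
  rw [Polygon.edgeSet, affineSegment_eq_segment, c.polygon_finRotate, c.polygon_apply]

/-- Two edges of the same half are separated by `g`, up to a shared vertex; edges of different
halves are separated by `h`, up to the base line. -/
lemma mem_endpoint_of_mem_segment (c : IsMonotoneChain S g h W r n) (hn : 3 ≤ n) {i j : ℕ}
    (hij : i < j) (hj : j < n) {z : Plane} (hzi : z ∈ segment ℝ (W i) (W (i + 1)))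
    (hzj : z ∈ segment ℝ (W j) (W (j + 1))) : z ∈ S := by
  have hr := c.pos
  obtain ⟨a, b, ha, hb, hab, hz⟩ := hzi
  obtain ⟨a', b', ha', hb', hab', hz'⟩ := hzj
  have ea : a = 1 - b := by linarith
  have ea' : a' = 1 - b' := by linarith
  subst ea ea'
  have gz : g z = (1 - b) * g (W i) + b * g (W (i + 1)) := by rw [← hz]; simp
  have gz' : g z = (1 - b') * g (W j) + b' * g (W (j + 1)) := by rw [← hz']; simp
  have hz1 : h z = (1 - b) * h (W i) + b * h (W (i + 1)) := by rw [← hz]; simp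
  have hz1' : h z = (1 - b') * h (W j) + b' * h (W (j + 1)) := by rw [← hz']; simp
  have fin : b' = 0 → z ∈ S := by
    rintro rfl
    rw [← hz']
    simpa using c.mem j
  have fin0 : b = 0 → z ∈ S := by
    rintro rfl
    rw [← hz]
    simpa using c.mem i
  have fin1 : 1 - b = 0 → z ∈ S := by
    intro hb
    have : b = 1 := by linarith
    subst this
    rw [← hz]
    simpa using c.mem (i + 1)
  have fin1' : 1 - b' = 0 → z ∈ S := by
    intro hb
    have : b' = 1 := by linarith
    subst this
    rw [← hz']
    simpa using c.mem (j + 1)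
  rcases lt_or_ge j r with hjr | hjr
  · apply fin
    have h1 := c.up i (by omega)
    have h2 := c.up j hjr
    have h3 : g (W (i + 1)) ≤ g (W j) := by
      rcases (show i + 1 ≤ j from hij).eq_or_lt with h | h
      · rw [h]
      · exact (c.g_lt_of_le h hjr.le).le
    by_contra hne
    have hb0 : 0 < b' := lt_of_le_of_ne hb' (Ne.symm hne)
    nlinarith [mul_pos hb0 (sub_pos.2 h2), mul_nonneg ha (sub_pos.2 h1).le]
  rcases le_or_gt r i with hir | hir
  · apply fin
    have h1 := c.down i hir (by omega)
    have h2 := c.down j hjr hj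
    have h3 : g (W j) ≤ g (W (i + 1)) := by
      rcases (show i + 1 ≤ j from hij).eq_or_lt with h | h
      · rw [h]
      · exact (c.g_lt_of_ge (by omega) h hj.le).le
    by_contra hne
    have hb0 : 0 < b' := lt_of_le_of_ne hb' (Ne.symm hne)
    nlinarith [mul_pos hb0 (sub_pos.2 h2), mul_nonneg ha (sub_pos.2 h1).le]
  · have u1 := mul_nonneg ha (sub_nonneg.2 (c.upper i hir.le))
    have u2 := mul_nonneg hb (sub_nonneg.2 (c.upper (i + 1) hir))
    have l1 := mul_nonneg ha' (sub_nonneg.2 (c.lower j hjr hj.le))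
    have l2 := mul_nonneg hb' (sub_nonneg.2 (c.lower (j + 1) (by omega) hj))
    -- `h z` is both at least and at most the base level, so each of the four weighted deviations
    -- vanishes.
    have v1 : (1 - b) * (h (W i) - h (W 0)) = 0 := by nlinarith
    have v2 : b * (h (W (i + 1)) - h (W 0)) = 0 := by nlinarith
    have v3 : (1 - b') * (h (W 0) - h (W j)) = 0 := by nlinarith
    have v4 : b' * (h (W 0) - h (W (j + 1))) = 0 := by nlinarith
    rcases mul_eq_zero.1 v1 with w1 | w1
    · exact fin1 w1
    rcases mul_eq_zero.1 v2 with w2 | w2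
    · exact fin0 w2
    rcases mul_eq_zero.1 v3 with w3 | w3
    · exact fin1' w3
    rcases mul_eq_zero.1 v4 with w4 | w4
    · exact fin w4
    -- Now both edges lie on the base line, which forces the two-vertex chain `i = 0`, `j = r = 1`,
    -- `n = 2`.
    have x1 := c.level i (by omega) (by linarith)
    have x2 := c.level (i + 1) (by omega) (by linarith)
    have x3 := c.level j hj (by linarith)
    rcases (show j + 1 ≤ n from hj).eq_or_lt with h | h
    · omega
    · have x4 := c.level (j + 1) h (by linarith)
      omega

lemma isPolygonization (c : IsMonotoneChain S g h W r n) (hn : 3 ≤ n)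
    (hS : InGeneralPosition (S : Set Plane)) : c.polygon.IsPolygonization (S : Set Plane) := by
  have hedge : ∀ i j : Fin n, i < j → ∀ z, z ∈ c.polygon.edgeSet ℝ i →
      z ∈ c.polygon.edgeSet ℝ j → z ∈ S := by
    intro i j hij z hi hj
    rw [c.edgeSet_polygon] at hi hj
    exact c.mem_endpoint_of_mem_segment hn hij j.2 hi hj
  have hvertex : ∀ i : Fin n, ∀ z ∈ S, z ∈ c.polygon.edgeSet ℝ i →
      z ∈ ({c.polygon i, c.polygon (finRotate n i)} : Set Plane) := by
    intro i z hz hi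
    rw [c.edgeSet_polygon] at hi
    rw [c.polygon_finRotate, c.polygon_apply]
    exact hS.eq_or_eq_of_mem_segment (c.mem _) (c.mem _) hz hi
  refine ⟨⟨hn, fun i j hij => Fin.ext (c.inj i i.2 j j.2 hij), ?_⟩, ?_⟩
  · rintro i j hij z ⟨hi, hj⟩
    have hz : z ∈ S := by
      rcases lt_or_gt_of_ne hij with h | h
      · exact hedge i j h z hi hj
      · exact hedge j i h z hj hi
    exact ⟨hvertex i z hz hi, hvertex j z hz hj⟩
  · ext s
    constructor
    · rintro ⟨i, rfl⟩
      exact c.mem i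
    · intro hs
      obtain ⟨i, hi, rfl⟩ := c.surj s hs
      exact ⟨⟨i, hi⟩, rfl⟩

lemma apply_succ_ne (c : IsMonotoneChain S g h W r n) {j : ℕ} (hj : j < n) :
    W j ≠ W (j + 1) := by
  intro he
  rcases lt_or_ge j r with h1 | h1
  · exact (c.up j h1).ne (congrArg g he)
  · exact (c.down j h1 hj).ne' (congrArg g he)

/-- Upper edges lie to one side of `W i` in the `g`-order, so `ray_notMem_segment` applies; lower
edges stay at or below the base level, which the ray strictly exceeds. -/
lemma upper_ray_notMem_boundary (c : IsMonotoneChain S g h W r n) {φ : Plane →ₗ[ℝ] ℝ} {v : Plane}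
    {i : ℕ} (hi : i < r) (hv : v ≠ 0) (hφv : φ v = 0) (hhv : 0 < h v)
    (hlt : ∀ s ∈ S, s ≠ W i → g s ≤ g (W i) → φ s < φ (W i))
    (hgt : ∀ s ∈ S, s ≠ W i → g (W i) ≤ g s → φ (W i) < φ s) {t : ℝ} (ht : 0 < t) :
    W i + t • v ∉ c.polygon.boundary ℝ := by
  intro hz
  obtain ⟨j, hj⟩ := Set.mem_iUnion.1 hz
  rw [c.edgeSet_polygon] at hj
  rcases lt_or_ge j.1 r with hjr | hjr
  · refine ray_notMem_segment hv hφv hlt hgt (c.mem _) (c.mem _) (c.apply_succ_ne j.2) ?_ ht hj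
    rcases lt_or_ge j.1 i with hji | hji
    · left
      refine ⟨(c.g_lt_of_le hji hi.le).le, ?_⟩
      rcases (show j.1 + 1 ≤ i from hji).eq_or_lt with h | h
      · rw [h]
      · exact (c.g_lt_of_le h hi.le).le
    · right
      refine ⟨?_, (c.g_lt_of_le (by omega) hjr).le⟩
      rcases hji.eq_or_lt with h | h
      · rw [h]
      · exact (c.g_lt_of_le h hjr.le).le
  · obtain ⟨a, b, ha, hb, hab, hz⟩ := hj
    have h1 := congrArg h hz
    simp only [map_add, map_smul, smul_eq_mul] at h1
    have l1 := mul_nonneg ha (sub_nonneg.2 (c.lower j hjr j.2.le))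
    have l2 := mul_nonneg hb (sub_nonneg.2 (c.lower (j + 1) (by omega) j.2))
    have l3 := c.upper i hi.le
    have l4 := mul_pos ht hhv
    have ea : a = 1 - b := by linarith
    subst ea
    linarith

lemma lower_ray_notMem_boundary (c : IsMonotoneChain S g h W r n) {φ : Plane →ₗ[ℝ] ℝ} {v : Plane}
    {i : ℕ} (hi : r ≤ i) (hin : i < n) (hv : v ≠ 0) (hφv : φ v = 0) (hhv : h v < 0)
    (hlt : ∀ s ∈ S, s ≠ W i → g s ≤ g (W i) → φ s < φ (W i))
    (hgt : ∀ s ∈ S, s ≠ W i → g (W i) ≤ g s → φ (W i) < φ s) {t : ℝ} (ht : 0 < t) :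
    W i + t • v ∉ c.polygon.boundary ℝ := by
  intro hz
  obtain ⟨j, hj⟩ := Set.mem_iUnion.1 hz
  rw [c.edgeSet_polygon] at hj
  rcases lt_or_ge j.1 r with hjr | hjr
  · obtain ⟨a, b, ha, hb, hab, hz⟩ := hj
    have h1 := congrArg h hz
    simp only [map_add, map_smul, smul_eq_mul] at h1
    have l1 := mul_nonneg ha (sub_nonneg.2 (c.upper j hjr.le))
    have l2 := mul_nonneg hb (sub_nonneg.2 (c.upper (j + 1) hjr))
    have l3 := c.lower i hi hin.le
    have l4 := mul_pos ht (neg_pos.2 hhv)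
    have ea : a = 1 - b := by linarith
    subst ea
    linarith
  · refine ray_notMem_segment hv hφv hlt hgt (c.mem _) (c.mem _) (c.apply_succ_ne j.2) ?_ ht hj
    rcases lt_or_ge j.1 i with hji | hji
    · right
      refine ⟨(c.g_lt_of_ge hjr hji hin.le).le, ?_⟩
      rcases (show j.1 + 1 ≤ i from hji).eq_or_lt with h | h
      · rw [h]
      · exact (c.g_lt_of_ge (by omega) h hin.le).le
    · left
      refine ⟨?_, (c.g_lt_of_ge hi (by omega) j.2).le⟩
      rcases hji.eq_or_lt with h | h
      · rw [h]
      · exact (c.g_lt_of_ge hi h j.2.le).le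

end IsMonotoneChain

/-! ### Choice of the vertical direction and assembly -/

/-- A nowhere vanishing continuous function keeps its sign on an interval. -/
lemma neg_of_neg_of_forall_ne_zero {f : ℝ → ℝ} (hf : Continuous f) {a b x y : ℝ}
    (hx : x ∈ Set.Ioo a b) (hy : y ∈ Set.Ioo a b) (h0 : ∀ z ∈ Set.Ioo a b, f z ≠ 0)
    (h : f x < 0) : f y < 0 := by
  by_contra! hc
  obtain ⟨z, hz, hz0⟩ := isPreconnected_Ioo.intermediate_value hx hy hf.continuousOn ⟨h.le, hc⟩
  exact h0 z hz hz0

/-- An open interval contains a direction that is the direction of no line through two points of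
a finite set. -/
lemma exists_mem_Ioo_side_ne_zero (S : Finset Plane) {a b : ℝ} (hab : a < b) :
    ∃ γ ∈ Set.Ioo a b, ∀ p ∈ S, ∀ q ∈ S, p ≠ q → side γ (p - q) ≠ 0 := by
  have hc : (⋃ w ∈ {w : Plane × Plane | w ∈ S ×ˢ S ∧ w.1 ≠ w.2},
      {θ | side θ (w.1 - w.2) = 0}).Countable := by
    refine Set.Countable.biUnion ?_ fun w hw => countable_setOf_side_eq_zero (sub_ne_zero.2 hw.2)
    exact ((S ×ˢ S).finite_toSet.subset fun w hw => hw.1).countable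
  obtain ⟨γ, hγ, hγ'⟩ := (hc.dense_compl ℝ).exists_mem_open isOpen_Ioo (Set.nonempty_Ioo.2 hab)
  refine ⟨γ, hγ', fun p hp q hq hpq h0 => hγ ?_⟩
  simp only [Set.mem_iUnion]
  exact ⟨(p, q), ⟨Finset.mk_mem_product hp hq, hpq⟩, h0⟩

/-- Some interval of directions of length `π / (|I| (|S| - 1))` contains the direction of no line
through a point of `I` and another point of `S`. -/
lemma exists_gap_side (S I : Finset Plane) (hIS : I ⊆ S) (hI : I.Nonempty) (hS : 1 < S.card) :
    ∃ α : ℝ, ∀ θ ∈ Set.Ioo α (α + Real.pi / (((S.card : ℝ) - 1) * I.card)),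
      ∀ p ∈ I, ∀ s ∈ S, s ≠ p → side θ (s - p) ≠ 0 := by
  classical
  -- Ordered pairs: a line through two points of `I` is counted twice, which gives the exact count
  -- |I|(|S| - 1).
  set F : Finset (Σ _ : Plane, Plane) := I.sigma fun p => S.erase p with hF
  have hcard : F.card = I.card * (S.card - 1) := by
    rw [hF, Finset.card_sigma, Finset.sum_congr rfl fun p hp => Finset.card_erase_of_mem (hIS hp)]
    simp
  have hFne : F.Nonempty := by
    rw [← Finset.card_pos, hcard]
    exact Nat.mul_pos (Finset.card_pos.2 hI) (by omega)
  have hex : ∀ w : (Σ _ : Plane, Plane), ∃ a : ℝ, w ∈ F →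
      ∀ θ, side θ (w.2 - w.1) = 0 ↔ Real.sin (θ - a) = 0 := by
    intro w
    by_cases hw : w ∈ F
    · have hne := (Finset.mem_erase.1 (Finset.mem_sigma.1 hw).2).1
      obtain ⟨a, ha⟩ := exists_side_eq_zero_iff (sub_ne_zero.2 hne)
      exact ⟨a, fun _ => ha⟩
    · exact ⟨0, fun h => absurd h hw⟩
  choose a ha using hex
  obtain ⟨α, hα⟩ := exists_gap F hFne a
  have hcast : (F.card : ℝ) = ((S.card : ℝ) - 1) * I.card := by
    rw [hcard, Nat.cast_mul, Nat.cast_sub hS.le]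
    push_cast; ring
  rw [hcast] at hα
  refine ⟨α, fun θ hθ p hp s hs hsp h0 => ?_⟩
  have hw : (⟨p, s⟩ : Σ _ : Plane, Plane) ∈ F :=
    Finset.mem_sigma.2 ⟨hp, Finset.mem_erase.2 ⟨hsp, hs⟩⟩
  exact hα θ hθ _ hw ((ha _ hw θ).1 h0)

/-- The height of a point over a line with direction `d`. -/
def height (d : Plane) : Plane →ₗ[ℝ] ℝ where
  toFun v := d 0 * v 1 - d 1 * v 0
  map_add' v w := by simp; ring
  map_smul' c v := by simp; ring

lemma height_apply (d v : Plane) : height d v = d 0 * v 1 - d 1 * v 0 := rfl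

lemma height_unitVec (d : Plane) (θ : ℝ) : height d (unitVec θ) = -side θ d := by
  simp [height_apply, side_apply]; ring

lemma collinear_of_height_eq {l u s : Plane} (hlu : l ≠ u)
    (h : height (u - l) s = height (u - l) l) : Collinear ℝ {l, u, s} := by
  rw [collinear_iff_of_mem (p₀ := l) (by simp)]
  refine ⟨u - l, ?_⟩
  rw [height_apply, height_apply] at h
  have hs : ∃ c : ℝ, s = c • (u - l) + l := by
    by_cases h0 : (u - l) 0 = 0
    · have h1 : (u - l) 1 ≠ 0 := by
        intro h1
        apply hlu
        refine (sub_eq_zero.1 ?_).symm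
        ext i; fin_cases i
        · exact h0
        · exact h1
      refine ⟨(s 1 - l 1) / (u - l) 1, ?_⟩
      ext i; fin_cases i
      · have : (u - l) 1 * (s 0 - l 0) = 0 := by rw [h0] at h; linarith
        have := (mul_eq_zero.1 this).resolve_left h1
        simp only [Fin.zero_eta, PiLp.add_apply, PiLp.smul_apply, smul_eq_mul, h0]
        linarith
      · simp only [Fin.mk_one, PiLp.add_apply, PiLp.smul_apply, smul_eq_mul]
        rw [div_mul_cancel₀ _ h1]; ring
    · refine ⟨(s 0 - l 0) / (u - l) 0, ?_⟩
      ext i; fin_cases i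
      · simp only [Fin.zero_eta, PiLp.add_apply, PiLp.smul_apply, smul_eq_mul]
        rw [div_mul_cancel₀ _ h0]; ring
      · simp only [Fin.mk_one, PiLp.add_apply, PiLp.smul_apply, smul_eq_mul]
        rw [div_mul_eq_mul_div, ← sub_eq_iff_eq_add, eq_div_iff h0]
        linarith
  simp only [Set.mem_insert_iff, Set.mem_singleton_iff, vadd_eq_add]
  rintro p (rfl | rfl | rfl)
  · exact ⟨0, by simp⟩
  · exact ⟨1, by simp⟩
  · exact hs

/-- If no line through `p` and another point of `S` has a direction in an interval around the
direction of the level lines of `-side γ`, then all these directions order `S` relative to `p` in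
the same way. -/
lemma side_lt_of_gap {S : Finset Plane} {p : Plane} {a b γ θ : ℝ} (hγ : γ ∈ Set.Ioo a b)
    (hθ : θ ∈ Set.Ioo a b)
    (hgap : ∀ θ ∈ Set.Ioo a b, ∀ s ∈ S, s ≠ p → side θ (s - p) ≠ 0) :
    (∀ s ∈ S, s ≠ p → (-side γ) s ≤ (-side γ) p → (-side θ) s < (-side θ) p) ∧
      ∀ s ∈ S, s ≠ p → (-side γ) p ≤ (-side γ) s → (-side θ) p < (-side θ) s := by
  constructor <;> intro s hs hsp hle <;> have h0 := hgap γ hγ s hs hsp <;>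
    simp only [LinearMap.neg_apply, map_sub, neg_le_neg_iff, neg_lt_neg_iff] at hle h0 ⊢
  · have := neg_of_neg_of_forall_ne_zero (f := fun z => -side z (s - p))
      (continuous_side _).neg hγ hθ (fun z hz => neg_ne_zero.2 (hgap z hz s hs hsp))
      (by rw [map_sub]; exact neg_neg_of_pos (lt_of_le_of_ne (sub_nonneg.2 hle) (Ne.symm h0)))
    simp only [map_sub] at this
    linarith
  · have := neg_of_neg_of_forall_ne_zero (f := fun z => side z (s - p))
      (continuous_side _) hγ hθ (fun z hz => hgap z hz s hs hsp)
      (by rw [map_sub]; exact lt_of_le_of_ne (sub_nonpos.2 hle) h0)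
    simp only [map_sub] at this
    linarith

lemma exists_polygonization_of_gap {S : Finset Plane} (hS3 : 3 ≤ S.card)
    (hS : InGeneralPosition (S : Set Plane)) {I : Finset Plane}
    (hsupp : ∀ p ∈ S, p ∉ I →
      ∃ v : Plane, v ≠ 0 ∧ ∀ s ∈ S, v 0 * (s 0 - p 0) + v 1 * (s 1 - p 1) ≤ 0)
    {α β : ℝ} (hβ0 : 0 < β) (hβ : β ≤ Real.pi)
    (hgap : ∀ θ ∈ Set.Ioo α (α + β), ∀ p ∈ I, ∀ s ∈ S, s ≠ p → side θ (s - p) ≠ 0) :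
    ∃ P : Polygon Plane S.card, P.IsPolygonization (S : Set Plane) ∧
      ∀ i, P.interiorAngle i ≤ 2 * Real.pi - β := by
  have hpi := Real.pi_pos
  -- The gap concerns only lines through points of `I`; injectivity of `g` needs `γ` to avoid all
  -- lines through two points of S.
  obtain ⟨γ, hγ, hγ'⟩ := exists_mem_Ioo_side_ne_zero S (lt_add_of_pos_right α hβ0)
  set g : Plane →ₗ[ℝ] ℝ := -side γ with hg
  have hinj : Set.InjOn g (S : Set Plane) := by
    intro p hp q hq hpq
    by_contra hne
    apply hγ' p hp q hq hne
    simp only [hg, LinearMap.neg_apply, neg_inj] at hpq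
    rw [map_sub, hpq, sub_self]
  have hne : S.Nonempty := Finset.card_pos.1 (by omega)
  obtain ⟨l, hl, hmin⟩ := S.exists_min_image g hne
  obtain ⟨u, hu, hmax⟩ := S.exists_max_image g hne
  have hlu : l ≠ u := by
    rintro rfl
    obtain ⟨s, hs, hsl⟩ := Finset.exists_mem_ne (by omega : 1 < S.card) l
    exact hsl (hinj hs hl (le_antisymm (hmax s hs) (hmin s hs)))
  obtain ⟨W, r, c, hW0, hWr⟩ := exists_isMonotoneChain S g (height (u - l)) hinj hl hu hlu hmin hmax
    (by simp only [height_apply, PiLp.sub_apply]; ring)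
    (by
      intro s hs he
      by_contra! hsne
      exact hS l hl u hu s hs hlu hsne.1.symm hsne.2.symm (collinear_of_height_eq hlu he))
  refine ⟨c.polygon, c.isPolygonization hS3 hS, fun i => ?_⟩
  have hconvex : (∃ v : Plane, v ≠ 0 ∧
      ∀ s ∈ S, v 0 * (s 0 - W i 0) + v 1 * (s 1 - W i 1) ≤ 0) →
      c.polygon.interiorAngle i ≤ 2 * Real.pi - β := by
    rintro ⟨v, hv, h⟩
    have := c.polygon.interiorAngle_le_pi_of_support i hv fun j => h _ (c.mem j)
    linarith
  by_cases hI : W i ∈ I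
  swap
  · exact hconvex (hsupp _ (c.mem i) hI)
  have hside : ∀ s : Plane, g s = Real.sin γ * s 0 - Real.cos γ * s 1 := by
    intro s; simp [hg, side_apply]
  have hnormal : unitVec (γ + Real.pi / 2) ≠ 0 := by
    rw [← norm_pos_iff, norm_unitVec]; exact one_pos
  by_cases hi0 : (i : ℕ) = 0
  -- The line of direction `γ` through `l` supports S, as `g` has gradient `-unitVec (γ + π/2)`.
  · refine hconvex ⟨unitVec (γ + Real.pi / 2), hnormal, fun s hs => ?_⟩
    have := hmin s hs
    rw [hside, hside] at this
    rw [hi0, hW0, unitVec_zero, unitVec_one, Real.cos_add_pi_div_two, Real.sin_add_pi_div_two]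
    linarith
  by_cases hir : (i : ℕ) = r
  · refine hconvex ⟨-unitVec (γ + Real.pi / 2), neg_ne_zero.2 hnormal, fun s hs => ?_⟩
    have := hmax s hs
    rw [hside, hside] at this
    rw [hir, hWr, PiLp.neg_apply, PiLp.neg_apply, unitVec_zero, unitVec_one,
      Real.cos_add_pi_div_two, Real.sin_add_pi_div_two]
    linarith
  have horder : ∀ θ ∈ Set.Ioo α (α + β), _ := fun θ hθ =>
    side_lt_of_gap (p := W i) hγ hθ fun z hz s hs hsp => hgap z hz _ hI s hs hsp
  have hWl : l ≠ W i := by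
    rw [← hW0]
    exact fun h => hi0 (c.inj 0 (by omega) i i.2 h).symm
  have hWu : u ≠ W i := by
    rw [← hWr]
    exact fun h => hir (c.inj r c.lt i i.2 h).symm
  -- `-side θ` keeps `l` before `W i` and `W i` before `u`, and its increase from `l` to `u` is
  -- exactly this height.
  have hheight : ∀ θ ∈ Set.Ioo α (α + β), 0 < height (u - l) (unitVec θ) := by
    intro θ hθ
    have h1 := (horder θ hθ).1 l hl hWl (hmin _ (c.mem i))
    have h2 := (horder θ hθ).2 u hu hWu (hmax _ (c.mem i))
    rw [height_unitVec, map_sub]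
    simp only [LinearMap.neg_apply] at h1 h2
    linarith
  have hunit : ∀ θ, unitVec θ ≠ 0 := by
    intro θ; rw [← norm_pos_iff, norm_unitVec]; exact one_pos
  rcases lt_or_ge (i : ℕ) r with h | h
  · refine c.polygon.interiorAngle_le_of_arc i (α := α) (by linarith) fun θ hθ t ht => ?_
    exact c.upper_ray_notMem_boundary h (hunit θ) (φ := -side θ) (by simp) (hheight θ hθ)
      (horder θ hθ).1 (horder θ hθ).2 ht
  · refine c.polygon.interiorAngle_le_of_arc i (α := α + Real.pi) (by linarith) fun θ hθ t ht => ?_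
    have hθ' : θ - Real.pi ∈ Set.Ioo α (α + β) := ⟨by linarith [hθ.1], by linarith [hθ.2]⟩
    have hu' : unitVec θ = -unitVec (θ - Real.pi) := by
      rw [← unitVec_add_pi, sub_add_cancel]
    rw [hu']
    exact c.lower_ray_notMem_boundary h i.2 (neg_ne_zero.2 (hunit _)) (φ := -side (θ - Real.pi))
      (by simp) (by rw [map_neg]; exact neg_neg_of_pos (hheight _ hθ'))
      (horder _ hθ').1 (horder _ hθ').2 ht

end

theorem theorem1 (S : Finset Plane) (n x : ℕ) (hn : S.card = n) (hn3 : 3 < n)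
    (hS : InGeneralPosition (S : Set Plane))
    (hx : (extremalPoints (S : Set Plane)).ncard = x) (hxn : x < n) :
    ∃ P : Polygon Plane n, P.IsPolygonization (S : Set Plane) ∧
      ∀ i : Fin n, P.interiorAngle i ≤
        2 * Real.pi - Real.pi / (((n : ℝ) - 1) * ((n : ℝ) - (x : ℝ))) := by
  classical
  subst hn
  have hpi := Real.pi_pos
  set E : Finset Plane := S.filter (· ∈ extremalPoints (S : Set Plane)) with hE
  have hEx : E.card = x := by
    rw [← hx, ← Set.ncard_coe_finset]
    congr 1
    ext s
    simp only [hE, Finset.coe_filter, Set.mem_ofPred_eq, and_iff_right_iff_imp]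
    exact fun hs => hs.1
  have hES : E ⊆ S := Finset.filter_subset _ _
  have hcard : ((S \ E).card : ℝ) = (S.card : ℝ) - x := by
    rw [Finset.card_sdiff_of_subset hES, hEx, Nat.cast_sub hxn.le]
  have hI : (S \ E).Nonempty := by
    rw [← Finset.card_pos, Finset.card_sdiff_of_subset hES, hEx]
    omega
  obtain ⟨α, hα⟩ := exists_gap_side S (S \ E) Finset.sdiff_subset hI (by omega)
  rw [hcard] at hα
  have h1 : (1 : ℝ) ≤ (S.card : ℝ) - 1 := by
    have : (3 : ℝ) < S.card := by exact_mod_cast hn3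
    linarith
  have h2 : (1 : ℝ) ≤ (S.card : ℝ) - x := by
    have : (x : ℝ) + 1 ≤ S.card := by exact_mod_cast hxn
    linarith
  -- The denominator is at least 1, so the gap is at most π, as the convex vertices require.
  have h3 := one_le_mul_of_one_le_of_one_le h1 h2
  refine exists_polygonization_of_gap (by omega) hS ?_ (by positivity) (div_le_self hpi.le h3) hα
  intro p hp hpI
  refine exists_support (hS.affineSpan_eq_top (by omega)) ?_
  have : p ∈ E := by
    by_contra hpE
    exact hpI (Finset.mem_sdiff.2 ⟨hp, hpE⟩)
  exact (Finset.mem_filter.1 this).2.2
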